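/- Let $\mathcal H$ be a complex Hilbert space and $U$ a unitary operator on $\mathcal H$ which is almost periodic, i.e. the orbit $\{U^nx: n=0,1,2,\dots\}$ of every $x\in\mathcal H$ is relatively compact in norm (equivalently, $\mathcal H$ is the closed linear span of the eigenvectors of $U$). Let $k\ge 1$, let $\alpha:\{1,\dots,2k\}\to\{1,\dots,k\}$ be a pair-partition, i.e. $|\alpha^{-1}(\{j\})|=2$ for each $j$, and let $A_1,\dots,A_{2k-1}$ be bounded operators on $\mathcal H$. For $z\in\mathbb C$ let $E_z$ be the orthogonal projection onto $\ker(U-z)$, let $\sigma_{\rm pp}(U)$ be the set of eigenvalues of $U$ and $$\sigma^{\rm a}_{\rm pp}(U)=\{z\in\sigma_{\rm pp}(U): zw=1 \text{ for some } w\in\sigma_{\rm pp}(U)\}.$$ For $z_1,\dots,z_k\in\mathbb C$ and $1\le i\le 2k$ with $\alpha(i)=j$, put $z^{\#}_{\alpha(i)}=z_j$ if $i$ is the smaller of the two elements of $\alpha^{-1}(\{j\})$, and $z^{\#}_{\alpha(i)}=\bar z_j$ if it is the larger one. Then the sum $$S_{\alpha;A_1,\dots,A_{2k-1}}=\sum_{z_1,\dots,z_k\in\sigma^{\rm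 a}_{\rm pp}(U)}E_{z^{\#}_{\alpha(1)}}A_1E_{z^{\#}_{\alpha(2)}}\cdots E_{z^{\#}_{\alpha(2k-1)}}A_{2k-1}E_{z^{\#}_{\alpha(2k)}}$$ exists as a bounded operator, being understood as the limit in the weak operator topology of the net of the finite truncations $\sum_{z_1,\dots,z_k\in F}$, indexed by the finite subsets $F\subset\sigma^{\rm a}_{\rm pp}(U)$ directed by inclusion, and $$\lim_{N\to+\infty}\frac1{N^k}\sum_{n_1,\dots,n_k=0}^{N-1}U^{n_{\alpha(1)}}A_1U^{n_{\alpha(2)}}\cdots U^{n_{\alpha(2k-1)}}A_{2k-1}U^{n_{\alpha(2k)}}=S_{\alpha;A_1,\dots,A_{2k-1}}$$ in the strong operator topology. -/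

import Mathlib

open Filter Topology

namespace EntangledErgodic

noncomputable section

variable {H : Type*} [NormedAddCommGroup H] [InnerProductSpace ℂ H] [CompleteSpace H]

/-- The orbit `{Uⁿ x : n = 0, 1, 2, …}` of a vector under a unitary operator. -/
def orbit (U : unitary (H →L[ℂ] H)) (x : H) : Set H :=
  Set.range fun n : ℕ => ((U : H →L[ℂ] H) ^ n) x

/-- `U` is almost periodic if the orbit of every vector is relatively compact in norm. -/
def IsAlmostPeriodic (U : unitary (H →L[ℂ] H)) : Prop :=
  ∀ x : H, IsCompact (closure (orbit U x))

/-- The pure point spectrum of `U`, i.e. the set of its eigenvalues (they lie on the unit circle,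
since `U` is unitary). -/
def sigmaPP (U : unitary (H →L[ℂ] H)) : Set ℂ :=
  {z | Module.End.HasEigenvalue ((U : H →L[ℂ] H) : H →ₗ[ℂ] H) z}

/-- The eigenvalues of `U` whose inverse is an eigenvalue as well. -/
def sigmaPPa (U : unitary (H →L[ℂ] H)) : Set ℂ :=
  {z | z ∈ sigmaPP U ∧ ∃ w ∈ sigmaPP U, z * w = 1}

/-- The selfadjoint projection onto the eigenspace of `U` for `z`. -/
def eigenProj (U : unitary (H →L[ℂ] H)) (z : ℂ) : H →L[ℂ] H :=
  (Module.End.eigenspace ((U : H →L[ℂ] H) : H →ₗ[ℂ] H) z).starProjection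

/-- The alternating product `P₁ A₁ P₂ A₂ ⋯ P_{m-1} A_{m-1} P_m` (and `1` if `m = 0`);
here the indices start from `0`. -/
def altProd {R : Type*} [Monoid R] : (m : ℕ) → (Fin m → R) → (Fin (m - 1) → R) → R
  | 0, _, _ => 1
  | 1, P, _ => P 0
  | m + 2, P, A => P 0 * A (0 : Fin (m + 1)) *
      altProd (m + 1) (fun i => P i.succ) (fun i : Fin m => A i.succ)

/-- `α : {1, …, 2k} → {1, …, k}` is a pair-partition: every part has exactly two elements. -/
def IsPairPartition {k : ℕ} (α : Fin (2 * k) → Fin k) : Prop :=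
  ∀ j : Fin k, (Finset.univ.filter fun i => α i = j).card = 2

/-- The multiple Cesàro mean
`N^{-k} ∑_{n₁, …, n_k = 0}^{N-1} U^{n_{α(1)}} A₁ U^{n_{α(2)}} ⋯ A_{2k-1} U^{n_{α(2k)}}`. -/
def entangledMean (U : unitary (H →L[ℂ] H)) {k : ℕ} (α : Fin (2 * k) → Fin k)
    (A : Fin (2 * k - 1) → H →L[ℂ] H) (N : ℕ) : H →L[ℂ] H :=
  ((N : ℂ) ^ k)⁻¹ • ∑ n ∈ Fintype.piFinset fun _ : Fin k => Finset.range N,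
    altProd (2 * k) (fun i => (U : H →L[ℂ] H) ^ n (α i)) A

open Classical in
/-- The sequence `z^#_{α(1)}, …, z^#_{α(2k)}`: for every `j`, it is `z_j` at the first and the
complex conjugate of `z_j` at the second of the two places `i` with `α i = j`. -/
def sharp {k : ℕ} (α : Fin (2 * k) → Fin k) (z : Fin k → ℂ) (i : Fin (2 * k)) : ℂ :=
  if ∃ i' < i, α i' = α i then star (z (α i)) else z (α i)

/-- The finite truncation
`∑_{z₁, …, z_k ∈ F} E_{z^#_{α(1)}} A₁ E_{z^#_{α(2)}} ⋯ A_{2k-1} E_{z^#_{α(2k)}}`,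
for a finite set `F` of eigenvalues in `sigmaPPa U`. -/
def truncSum (U : unitary (H →L[ℂ] H)) {k : ℕ} (α : Fin (2 * k) → Fin k)
    (A : Fin (2 * k - 1) → H →L[ℂ] H) (F : Finset (sigmaPPa U)) : H →L[ℂ] H :=
  ∑ z ∈ Fintype.piFinset fun _ : Fin k => F,
    altProd (2 * k) (fun i => eigenProj U (sharp α (fun j => (z j : ℂ)) i)) A

/-- `S` is the sum
`∑_{z₁, …, z_k ∈ sigmaPPa U} E_{z^#_{α(1)}} A₁ E_{z^#_{α(2)}} ⋯ A_{2k-1} E_{z^#_{α(2k)}}`,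
that is, the limit in the weak operator topology of the net of the finite truncations, which is
indexed by the finite subsets of `sigmaPPa U` directed by inclusion. -/
def IsEntangledSum (U : unitary (H →L[ℂ] H)) {k : ℕ} (α : Fin (2 * k) → Fin k)
    (A : Fin (2 * k - 1) → H →L[ℂ] H) (S : H →L[ℂ] H) : Prop :=
  Tendsto (fun F : Finset (sigmaPPa U) => ContinuousLinearMapWOT.ofCLM (truncSum U α A F)) atTop
    (𝓝 (ContinuousLinearMapWOT.ofCLM S))

end

end EntangledErgodic

/-! An almost periodic unitary has eigenvectors spanning a dense subspace, so a product can be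
evaluated from its right end on eigenvectors. If `U x = v • x`, the right place of a letter `j`
contributes the scalar `v ^ n`, which moves to the left place of `j`. When that place becomes the
rightmost one, its letter occurs nowhere else and can be averaged alone: the mean ergodic theorem
gives the strong limit `E_{conj v}` of the means of `v ^ n • U ^ n`. Since all factors are bounded
by fixed constants, the inner limit may be inserted before the rest is averaged, and convergence
passes from eigenvectors to their closed span. Induction on the length of the word
(`exists_tendsto_mean`) gives strong convergence for every pair-partition.

The truncations are treated by the same induction. A uniform bound on them is not evident from the
defining sum, but characters `χ` of a finite cyclic group, orthonormal on `F`, write `∑ z ∈ F, E_z ⊗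
E_{conj z}` as an average of `B t ⊗ C t` with contractions `B t = ∑ χ t z • E_z` and `C t = ∑ conj
(χ t z) • E_{conj z}`. On the eigenspace of `v` the one-letter averages again tend to `E_{conj v}`.
Both families are thus instances of `PairedAverages` with the same one-letter limits; gluing them
into one net along the supremum of the two filters forces the limits of all words to agree.

For density, a nonzero `x` orthogonal to all eigenvectors would give a nonzero compact symmetric
operator commuting with `U`, a limit of means of `⟪U ^ n x, ·⟫ U ^ n x`. Its finite-dimensional
eigenspaces contain eigenvectors of `U` orthogonal to all eigenvectors, a contradiction. -/

namespace EntangledErgodic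

/-! ### Density of the span of the eigenvectors -/

section Density

open scoped ComplexConjugate

variable {H : Type*} [NormedAddCommGroup H] [InnerProductSpace ℂ H]

local notation "⟪" x ", " y "⟫" => inner ℂ x y

/-- The Cesàro means of the rank one operators `y ↦ ⟪u n, y⟫ • u n`. -/
noncomputable def rankOneMean (u : ℕ → H) (N : ℕ) : H →ₗ[ℂ] H where
  toFun y := ((N : ℂ) + 1)⁻¹ • ∑ n ∈ Finset.range (N + 1), ⟪u n, y⟫ • u n
  map_add' y z := by simp [add_smul, Finset.sum_add_distrib]
  map_smul' c y := by
    simp [Finset.smul_sum, smul_smul, mul_left_comm]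

theorem rankOneMean_apply (u : ℕ → H) (N : ℕ) (y : H) :
    rankOneMean u N y = ((N : ℂ) + 1)⁻¹ • ∑ n ∈ Finset.range (N + 1), ⟪u n, y⟫ • u n := rfl

theorem rankOneMean_symm (u : ℕ → H) (N : ℕ) (y z : H) :
    ⟪rankOneMean u N y, z⟫ = ⟪y, rankOneMean u N z⟫ := by
  simp only [rankOneMean_apply, inner_smul_left, inner_smul_right, sum_inner, inner_sum,
    inner_conj_symm]
  congr 1
  · simp
  · exact Finset.sum_congr rfl fun n _ => mul_comm _ _

theorem isSymmetric_of_ultralimit {u : ℕ → H} {T : H →L[ℂ] H}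
    (hT : ∀ y, Tendsto (fun N => rankOneMean u N y) (hyperfilter ℕ : Filter ℕ) (𝓝 (T y))) :
    (T : H →ₗ[ℂ] H).IsSymmetric := fun y z =>
  tendsto_nhds_unique
    (((hT y).inner tendsto_const_nhds).congr fun N => rankOneMean_symm u N y z)
    (tendsto_const_nhds.inner (hT z))

theorem ultralimit_mem {u : ℕ → H} {T : H →L[ℂ] H}
    (hT : ∀ y, Tendsto (fun N => rankOneMean u N y) (hyperfilter ℕ : Filter ℕ) (𝓝 (T y)))
    (K : Submodule ℂ H) (hK : IsClosed (K : Set H)) (huK : ∀ n, u n ∈ K) (y : H) : T y ∈ K :=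
  hK.mem_of_tendsto (hT y) (Eventually.of_forall fun _ =>
    K.smul_mem _ (K.sum_mem fun n _ => K.smul_mem _ (huK n)))

/-- A compact convex set which contains the vectors `c • u n` with `‖c‖ ≤ r`. -/
def scaledHull (u : ℕ → H) (r : ℝ) : Set H :=
  closedAbsConvexHull ℝ ((fun p : ℂ × H => p.1 • p.2) ''
    (Metric.closedBall 0 r ×ˢ closure (Set.range u)))

/-- The coefficients `⟪u n, y⟫` are bounded by `R * ‖y‖`, and the mean is a convex combination. As
the hull is compact for relatively compact `u`, limits along an ultrafilter exist. -/
theorem rankOneMean_mem_scaledHull {u : ℕ → H} {R : ℝ} (huR : ∀ n, ‖u n‖ ≤ R) (N : ℕ) (y : H) :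
    rankOneMean u N y ∈ scaledHull u (R * ‖y‖) := by
  have hconv : Convex ℝ (scaledHull u (R * ‖y‖)) := (absConvex_convexClosedHull (𝕜 := ℝ)).2
  have hmem : ∀ n, ⟪u n, y⟫ • u n ∈ scaledHull u (R * ‖y‖) := by
    intro n
    refine subset_closedAbsConvexHull ⟨(⟪u n, y⟫, u n), ⟨?_, subset_closure ⟨n, rfl⟩⟩, rfl⟩
    simp only [mem_closedBall_zero_iff]
    exact (norm_inner_le_norm _ _).trans (by gcongr; exact huR n)
  have := hconv.sum_mem (t := Finset.range (N + 1)) (w := fun _ => ((N : ℝ) + 1)⁻¹)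
    (z := fun n => ⟪u n, y⟫ • u n) (fun _ _ => by positivity)
    (by rw [Finset.sum_const, Finset.card_range, nsmul_eq_mul]; push_cast; field_simp)
    (fun n _ => hmem n)
  rw [← Finset.smul_sum] at this
  rw [rankOneMean_apply]
  convert this using 1
  rw [← Complex.coe_smul]
  push_cast
  rfl

/-- Total boundedness yields finitely many `y` such that every `u n` is far from orthogonal to one
of them; the quadratic forms at these `y` then have a sum bounded below uniformly in `N`. -/
theorem ultralimit_ne_zero {u : ℕ → H} (hu : IsCompact (closure (Set.range u))) {R : ℝ}
    (hR : 0 < R) (huR : ∀ n, ‖u n‖ = R) {T : H →L[ℂ] H}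
    (hT : ∀ y, Tendsto (fun N => rankOneMean u N y) (hyperfilter ℕ : Filter ℕ) (𝓝 (T y))) :
    T ≠ 0 := by
  rintro rfl
  obtain ⟨t, ht⟩ := (Metric.totallyBounded_iff.1 (hu.totallyBounded.subset subset_closure))
    (R / 2) (by positivity)
  obtain ⟨htf, hcover⟩ := ht
  have hlow : ∀ n, (R ^ 2 / 2) ^ 2 ≤ ∑ y ∈ htf.toFinset, ‖⟪u n, y⟫‖ ^ 2 := by
    intro n
    obtain ⟨y, hy, hny⟩ := Set.mem_iUnion₂.1 (hcover ⟨n, rfl⟩)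
    have h1 : R ^ 2 / 2 ≤ ‖⟪u n, y⟫‖ := by
      have e : ⟪u n, u n⟫ = ⟪u n, y⟫ + ⟪u n, u n - y⟫ := by rw [inner_sub_right]; ring
      have e1 : ‖⟪u n, u n⟫‖ = R ^ 2 := by
        rw [inner_self_eq_norm_sq_to_K, huR]; simp
      have e2 : ‖⟪u n, u n - y⟫‖ ≤ R * (R / 2) := by
        refine (norm_inner_le_norm _ _).trans ?_
        rw [huR]
        have : ‖u n - y‖ ≤ R / 2 := by
          rw [← dist_eq_norm]; exact (Metric.mem_ball.1 hny).le
        gcongr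
      have := norm_add_le ⟪u n, y⟫ ⟪u n, u n - y⟫
      rw [← e, e1] at this
      linarith
    calc (R ^ 2 / 2) ^ 2 ≤ ‖⟪u n, y⟫‖ ^ 2 := by gcongr
      _ ≤ _ := Finset.single_le_sum (f := fun y => ‖⟪u n, y⟫‖ ^ 2) (fun _ _ => by positivity)
        (htf.mem_toFinset.2 hy)
  have hmean : ∀ N, (R ^ 2 / 2) ^ 2 ≤ (∑ y ∈ htf.toFinset, ⟪rankOneMean u N y, y⟫).re := by
    intro N
    have e : ∀ y, ⟪rankOneMean u N y, y⟫.re =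
        ((N : ℝ) + 1)⁻¹ * ∑ n ∈ Finset.range (N + 1), ‖⟪u n, y⟫‖ ^ 2 := by
      intro y
      have : ⟪rankOneMean u N y, y⟫ =
          ((((N : ℝ) + 1)⁻¹ * ∑ n ∈ Finset.range (N + 1), ‖⟪u n, y⟫‖ ^ 2 : ℝ) : ℂ) := by
        simp only [rankOneMean_apply, inner_smul_left, sum_inner]
        push_cast
        congr 1
        · simp
        · refine Finset.sum_congr rfl fun n _ => ?_
          rw [Complex.conj_mul']
      rw [this, Complex.ofReal_re]
    rw [Complex.re_sum]
    simp only [e]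
    rw [← Finset.mul_sum, Finset.sum_comm]
    have hpos : (0 : ℝ) < (N : ℝ) + 1 := by positivity
    rw [le_inv_mul_iff₀ hpos]
    calc ((N : ℝ) + 1) * (R ^ 2 / 2) ^ 2
        = ∑ n ∈ Finset.range (N + 1), (R ^ 2 / 2) ^ 2 := by simp
      _ ≤ _ := Finset.sum_le_sum fun n _ => hlow n
  have hlim : Tendsto (fun N => (∑ y ∈ htf.toFinset, ⟪rankOneMean u N y, y⟫).re)
      (hyperfilter ℕ : Filter ℕ) (𝓝 0) := by
    have : Tendsto (fun N => ∑ y ∈ htf.toFinset, ⟪rankOneMean u N y, y⟫)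
        (hyperfilter ℕ : Filter ℕ) (𝓝 (∑ y ∈ htf.toFinset, ⟪(0 : H →L[ℂ] H) y, y⟫)) :=
      tendsto_finsetSum _ fun y _ => (hT y).inner tendsto_const_nhds
    have h := (Complex.continuous_re.tendsto _).comp this
    simp only [zero_apply, inner_zero_left, Finset.sum_const_zero, Complex.zero_re] at h
    exact h
  have := ge_of_tendsto' hlim hmean
  have : 0 < (R ^ 2 / 2) ^ 2 := by positivity
  linarith

variable [CompleteSpace H]

theorem inner_map_map (U : unitary (H →L[ℂ] H)) (x y : H) :
    ⟪(U : H →L[ℂ] H) x, (U : H →L[ℂ] H) y⟫ = ⟪x, y⟫ :=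
  ContinuousLinearMap.inner_map_map_of_mem_unitary U.2 x y

theorem norm_map (U : unitary (H →L[ℂ] H)) (x : H) : ‖(U : H →L[ℂ] H) x‖ = ‖x‖ :=
  ContinuousLinearMap.norm_map_of_mem_unitary U.2 x

theorem norm_pow_apply (U : unitary (H →L[ℂ] H)) (n : ℕ) (x : H) :
    ‖((U : H →L[ℂ] H) ^ n) x‖ = ‖x‖ := norm_map (U ^ n) x

theorem isCompact_scaledHull {u : ℕ → H} (hu : IsCompact (closure (Set.range u))) (r : ℝ) :
    IsCompact (scaledHull u r) := by
  refine isCompact_closedAbsConvexHull_of_totallyBounded ?_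
  refine (((isCompact_closedBall (0 : ℂ) r).prod hu).image ?_).totallyBounded
  fun_prop

/-- A cluster point of the Cesàro means of the rank one operators of a relatively compact
sequence: it is a limit along an ultrafilter. -/
theorem exists_ultralimit_rankOneMean {u : ℕ → H} (hu : IsCompact (closure (Set.range u)))
    {R : ℝ} (huR : ∀ n, ‖u n‖ ≤ R) :
    ∃ T : H →L[ℂ] H, IsCompactOperator T ∧
      ∀ y, Tendsto (fun N => rankOneMean u N y) (hyperfilter ℕ : Filter ℕ) (𝓝 (T y)) := by
  have key : ∀ y, ∃ z ∈ scaledHull u (R * ‖y‖),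
      Tendsto (fun N => rankOneMean u N y) (hyperfilter ℕ : Filter ℕ) (𝓝 z) := fun y =>
    (isCompact_scaledHull hu _).ultrafilter_le_nhds ((hyperfilter ℕ).map _)
      (by
        rw [le_principal_iff]
        exact mem_map.2 (Eventually.of_forall fun N : ℕ => rankOneMean_mem_scaledHull huR N y))
  choose T hTmem hT using key
  let T' : H →ₗ[ℂ] H :=
    { toFun := T
      map_add' := fun y z => by
        refine tendsto_nhds_unique (hT (y + z)) ?_
        simpa only [map_add] using (hT y).add (hT z)
      map_smul' := fun c y => by
        refine tendsto_nhds_unique (hT (c • y)) ?_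
        simpa only [map_smul, RingHom.id_apply] using (hT y).const_smul c }
  have hR : 0 ≤ R := (norm_nonneg _).trans (huR 0)
  -- The scaled hulls increase with the radius, so the one of radius `R` contains the image of the
  -- whole unit ball.
  have hc : IsCompactOperator T' := by
    rw [isCompactOperator_iff_image_closedBall_subset_compact T' zero_lt_one]
    refine ⟨_, isCompact_scaledHull hu R, ?_⟩
    rintro _ ⟨y, hy, rfl⟩
    refine (closedAbsConvexHull (E := H) ℝ).monotone
      (Set.image_mono (Set.prod_mono_left ?_)) (hTmem y)
    refine Metric.closedBall_subset_closedBall ?_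
    rw [mem_closedBall_zero_iff] at hy
    nlinarith
  exact ⟨⟨T', hc.continuous⟩, hc, hT⟩

/-- Conjugation by `U` shifts the index of the rank one operators, so the commutator with a mean
telescopes to two bounded terms divided by `N + 1`. -/
theorem ultralimit_commute (U : unitary (H →L[ℂ] H)) (x : H) {T : H →L[ℂ] H}
    (hT : ∀ y, Tendsto (fun N => rankOneMean (fun n => ((U : H →L[ℂ] H) ^ n) x) N y)
      (hyperfilter ℕ : Filter ℕ) (𝓝 (T y))) (y : H) :
    T ((U : H →L[ℂ] H) y) = (U : H →L[ℂ] H) (T y) := by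
  set u : ℕ → H := fun n => ((U : H →L[ℂ] H) ^ n) x with hu
  have hstep : ∀ n, (U : H →L[ℂ] H) (u n) = u (n + 1) := fun n => by
    simp only [hu, pow_succ', mul_apply_eq_comp]
  set f : ℕ → H := fun n => ⟪u n, (U : H →L[ℂ] H) y⟫ • u n with hf
  have hdiff : ∀ N, (U : H →L[ℂ] H) (rankOneMean u N y) =
      rankOneMean u N ((U : H →L[ℂ] H) y) + ((N : ℂ) + 1)⁻¹ • (f (N + 1) - f 0) := by
    intro N
    have : ∀ n, (U : H →L[ℂ] H) (⟪u n, y⟫ • u n) = f (n + 1) := by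
      intro n
      rw [map_smul, hstep, ← inner_map_map U (u n) y, hstep]
    rw [rankOneMean_apply, rankOneMean_apply, map_smul, map_sum]
    simp only [this]
    rw [← smul_add, ← Finset.sum_range_sub]
    simp [hf]
  have hzero : Tendsto (fun N : ℕ => ((N : ℂ) + 1)⁻¹ • (f (N + 1) - f 0)) atTop (𝓝 0) := by
    have hfb : ∀ n, ‖f n‖ ≤ ‖x‖ * ‖y‖ * ‖x‖ := by
      intro n
      rw [hf, norm_smul]
      have h1 : ‖u n‖ = ‖x‖ := norm_pow_apply U n x
      have h2 := norm_inner_le_norm (𝕜 := ℂ) (u n) ((U : H →L[ℂ] H) y)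
      rw [norm_map, h1] at h2
      rw [h1]
      gcongr
    refine Tendsto.zero_smul_isBoundedUnder_le ?_ ?_
    · have := tendsto_one_div_add_atTop_nhds_zero_nat (𝕜 := ℂ)
      simpa using this
    · exact isBoundedUnder_of ⟨2 * (‖x‖ * ‖y‖ * ‖x‖), fun n => by
        simp only [Function.comp]
        exact (norm_sub_le _ _).trans (by linarith [hfb (n + 1), hfb 0])⟩
  have h1 : Tendsto (fun N => (U : H →L[ℂ] H) (rankOneMean u N y)) (hyperfilter ℕ : Filter ℕ)
      (𝓝 ((U : H →L[ℂ] H) (T y))) :=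
    (((U : H →L[ℂ] H)).continuous.tendsto _).comp (hT y)
  have h2 : Tendsto (fun N => (U : H →L[ℂ] H) (rankOneMean u N y)) (hyperfilter ℕ : Filter ℕ)
      (𝓝 (T ((U : H →L[ℂ] H) y) + 0)) := by
    simp only [hdiff]
    exact (hT _).add (hzero.mono_left Nat.hyperfilter_le_atTop)
  rw [add_zero] at h2
  exact tendsto_nhds_unique h2 h1

/-- A symmetric compact operator `T ≠ 0` which commutes with `U` has an eigenvector of `U` in its
range. -/
theorem exists_eigenvector_mem_range (U T : H →L[ℂ] H) (hc : IsCompactOperator T)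
    (hs : (T : H →ₗ[ℂ] H).IsSymmetric) (h0 : T ≠ 0) (hcomm : ∀ y, T (U y) = U (T y)) :
    ∃ g : H, g ≠ 0 ∧ (∃ w, T w = g) ∧ ∃ v : ℂ, U g = v • g := by
  obtain ⟨μ, hμ, hμ0⟩ : ∃ μ, Module.End.HasEigenvalue (T : H →ₗ[ℂ] H) μ ∧ μ ≠ 0 := by
    by_contra! h
    exact h0 ((T.eq_zero_of_forall_hasEigenvalue_eq_zero hc hs).1 h)
  set G := Module.End.eigenspace (T : H →ₗ[ℂ] H) μ with hG
  have : FiniteDimensional ℂ G := T.finite_dimensional_eigenspace hc μ hμ0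
  have hGmap : ∀ g ∈ G, (U : H →ₗ[ℂ] H) g ∈ G := by
    intro g hg
    rw [hG, Module.End.mem_eigenspace_iff] at hg ⊢
    simp only [ContinuousLinearMap.coe_coe] at hg ⊢
    rw [hcomm, hg, map_smul]
  have : Nontrivial G := Submodule.nontrivial_iff_ne_bot.2 hμ
  obtain ⟨v, hv⟩ := Module.End.exists_eigenvalue ((U : H →ₗ[ℂ] H).restrict hGmap)
  obtain ⟨g, hg⟩ := hv.exists_hasEigenvector
  refine ⟨g, fun h => hg.2 (Subtype.ext h), ⟨μ⁻¹ • (g : H), ?_⟩, v, ?_⟩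
  · have : T g = μ • (g : H) := Module.End.mem_eigenspace_iff.1 g.2
    rw [map_smul, this, smul_smul, inv_mul_cancel₀ hμ0, one_smul]
  · exact congrArg Subtype.val hg.apply_eq_smul

theorem norm_eq_one_of_mem_sigmaPP {U : unitary (H →L[ℂ] H)} {v : ℂ} (hv : v ∈ sigmaPP U) :
    ‖v‖ = 1 := by
  obtain ⟨g, hg⟩ := Module.End.HasEigenvalue.exists_hasEigenvector hv
  have h : (U : H →L[ℂ] H) g = v • g := hg.apply_eq_smul
  have h1 := norm_map U g
  rw [h, norm_smul] at h1
  have : ‖g‖ ≠ 0 := norm_ne_zero_iff.2 hg.2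
  exact mul_right_cancel₀ this (by rw [h1, one_mul])

/-- The eigenvectors of an almost periodic unitary operator span a dense subspace. -/
theorem IsAlmostPeriodic.dense_span_eigenvectors {U : unitary (H →L[ℂ] H)}
    (hU : IsAlmostPeriodic U) :
    (⨆ v : sigmaPP U,
      Module.End.eigenspace ((U : H →L[ℂ] H) : H →ₗ[ℂ] H) (v : ℂ)).topologicalClosure = ⊤ := by
  set L : Submodule ℂ H :=
    ⨆ v : sigmaPP U, Module.End.eigenspace ((U : H →L[ℂ] H) : H →ₗ[ℂ] H) (v : ℂ) with hL
  rw [Submodule.topologicalClosure_eq_top_iff, Submodule.eq_bot_iff]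
  intro x hx
  by_contra hx0
  set u : ℕ → H := fun n => ((U : H →L[ℂ] H) ^ n) x with hu
  have hmem : ∀ {y : H} {v : ℂ}, y ≠ 0 → (U : H →L[ℂ] H) y = v • y → y ∈ L := by
    intro y v hy hv
    have hy' : y ∈ Module.End.eigenspace ((U : H →L[ℂ] H) : H →ₗ[ℂ] H) v :=
      Module.End.mem_eigenspace_iff.2 hv
    exact Submodule.mem_iSup_of_mem
      ⟨v, Module.End.hasEigenvalue_of_hasEigenvector ⟨hy', hy⟩⟩ hy'
  -- On an eigenvector `g` of `L`, `U` is a nonzero scalar and preserves inner products, so `⟪g, y⟫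
  -- = 0` gives `⟪g, U y⟫ = 0`.
  have hinv : ∀ y ∈ Lᗮ, (U : H →L[ℂ] H) y ∈ Lᗮ := by
    intro y hy
    rw [hL, ← Submodule.iInf_orthogonal, Submodule.mem_iInf] at hy ⊢
    intro v
    rw [Submodule.mem_orthogonal]
    intro g hg
    have hv0 : (v : ℂ) ≠ 0 := by
      rw [← norm_pos_iff, norm_eq_one_of_mem_sigmaPP v.2]; exact one_pos
    have hg' : (U : H →L[ℂ] H) g = (v : ℂ) • g := Module.End.mem_eigenspace_iff.1 hg
    have : conj (v : ℂ) * ⟪g, (U : H →L[ℂ] H) y⟫ = 0 := by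
      rw [← inner_smul_left, ← hg', inner_map_map]
      exact (Submodule.mem_orthogonal _ _).1 (hy v) g hg
    exact (mul_eq_zero.1 this).resolve_left (by simpa using hv0)
  have huL : ∀ n, u n ∈ Lᗮ := by
    intro n
    induction n with
    | zero => simpa [hu] using hx
    | succ n ih =>
      have : u (n + 1) = (U : H →L[ℂ] H) (u n) := by
        simp only [hu, pow_succ', mul_apply_eq_comp]
      rw [this]
      exact hinv _ ih
  have hcomp : IsCompact (closure (Set.range u)) := hU x
  have hnorm : ∀ n, ‖u n‖ = ‖x‖ := fun n => norm_pow_apply U n x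
  obtain ⟨T, hTc, hT⟩ := exists_ultralimit_rankOneMean hcomp fun n => (hnorm n).le
  obtain ⟨g, hg0, ⟨w, rfl⟩, v, hv⟩ := exists_eigenvector_mem_range (U : H →L[ℂ] H) T hTc
    (isSymmetric_of_ultralimit hT) (ultralimit_ne_zero hcomp (norm_pos_iff.2 hx0) hnorm hT)
    (ultralimit_commute U x hT)
  have h1 : T w ∈ Lᗮ := ultralimit_mem hT _ (Submodule.isClosed_orthogonal _) huL w
  exact hg0 (inner_self_eq_zero.1 ((Submodule.mem_orthogonal _ _).1 h1 _ (hmem hg0 hv)))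

end Density

/-! ### Finite averages -/

section Averages

variable {T E : Type*} [Fintype T] [NormedAddCommGroup E] [NormedSpace ℂ E]

/-- The average of a function on a finite type. -/
noncomputable def avg (f : T → E) : E := (Fintype.card T : ℂ)⁻¹ • ∑ t, f t

theorem avg_const [Nonempty T] (x : E) : avg (fun _ : T => x) = x := by
  have : (Fintype.card T : ℂ) ≠ 0 := Nat.cast_ne_zero.2 Fintype.card_ne_zero
  rw [avg, Finset.sum_const, Finset.card_univ, ← Nat.cast_smul_eq_nsmul ℂ, smul_smul,
    inv_mul_cancel₀ this, one_smul]

theorem avg_add (f g : T → E) : avg (fun t => f t + g t) = avg f + avg g := by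
  simp [avg, Finset.sum_add_distrib]

theorem avg_sub (f g : T → E) : avg (fun t => f t - g t) = avg f - avg g := by
  simp [avg, Finset.sum_sub_distrib, smul_sub]

theorem avg_smul (c : ℂ) (f : T → E) : avg (fun t => c • f t) = c • avg f := by
  rw [avg, avg, ← Finset.smul_sum, smul_comm]

theorem map_avg {F : Type*} [NormedAddCommGroup F] [NormedSpace ℂ F] (A : E →L[ℂ] F) (f : T → E) :
    A (avg f) = avg fun t => A (f t) := by
  simp [avg]

theorem norm_avg_le [Nonempty T] {f : T → E} {R : ℝ} (h : ∀ t, ‖f t‖ ≤ R) : ‖avg f‖ ≤ R := by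
  have hc : (0 : ℝ) < Fintype.card T := Nat.cast_pos.2 Fintype.card_pos
  rw [avg, norm_smul, norm_inv, Complex.norm_natCast, inv_mul_le_iff₀ hc]
  calc ‖∑ t, f t‖ ≤ ∑ _t : T, R := norm_sum_le_of_le _ fun t _ => h t
    _ = _ := by simp

/-- Averaging over one coordinate first does not change the average over all coordinates. -/
theorem avg_update {J : Type*} [Fintype J] [DecidableEq J] [Nonempty T] (j : J)
    (f : (J → T) → E) : avg f = avg fun t => avg fun s => f (Function.update t j s) := by
  -- Exchanging the coordinate at `j` with the extra variable is an involution, which reindexes the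
  -- double sum.
  let e : (J → T) × T → (J → T) × T := fun p => (Function.update p.1 j p.2, p.1 j)
  have he : Function.Involutive e := fun p => by simp [e]
  have hsum : ∑ t, ∑ s, f (Function.update t j s) = (Fintype.card T : ℂ) • ∑ t, f t := by
    rw [← Fintype.sum_prod_type' fun t s => f (Function.update t j s)]
    refine (Equiv.sum_comp he.toPerm fun p => f p.1).trans ?_
    rw [Fintype.sum_prod_type]
    simp [Finset.smul_sum, ← Nat.cast_smul_eq_nsmul ℂ]
  have hc : (Fintype.card T : ℂ) ≠ 0 := Nat.cast_ne_zero.2 Fintype.card_ne_zero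
  simp only [avg]
  rw [← Finset.smul_sum, hsum, inv_smul_smul₀ hc]

end Averages

/-! ### Words in operators and their scalar replacements -/

section Words

variable {H : Type*} [NormedAddCommGroup H] [InnerProductSpace ℂ H]
variable {J T V : Type*} [DecidableEq J]

/-- The operator at one place of a word. The rightmost of the two places of a letter `j` carries
`C (t j)`, the other one `B (t j)`; once the right place of `j` has been replaced by the scalar
`γ (t j) v`, where `a j = some v`, this scalar is attached to the left place. The argument `L` is
the list of the letters at the left of the place. -/
def letter (B C : T → H →L[ℂ] H) (γ : T → V → ℂ) (a : J → Option V) (t : J → T) (L : List J)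
    (j : J) : H →L[ℂ] H :=
  if j ∈ L then C (t j) else (a j).elim (B (t j)) fun v => γ (t j) v • B (t j)

/-- The value of a word, which is listed from the right to the left. -/
def word (B C : T → H →L[ℂ] H) (γ : T → V → ℂ) (a : J → Option V) (t : J → T) :
    List ((H →L[ℂ] H) × J) → H →L[ℂ] H
  | [] => 1
  | (A, j) :: w => word B C γ a t w * (A * letter B C γ a t (w.map Prod.snd) j)

variable {B C : T → H →L[ℂ] H} {γ : T → V → ℂ}

theorem word_congr {a : J → Option V} {t t' : J → T} {w : List ((H →L[ℂ] H) × J)}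
    (h : ∀ j ∈ w.map Prod.snd, t j = t' j) : word B C γ a t w = word B C γ a t' w := by
  induction w with
  | nil => rfl
  | cons p w ih =>
    obtain ⟨A, j⟩ := p
    simp only [List.map_cons, List.mem_cons, forall_eq_or_imp] at h
    simp only [word, letter]
    rw [ih h.2, h.1]

theorem norm_word_apply_le (hB : ∀ t, ‖B t‖ ≤ 1) (hC : ∀ t, ‖C t‖ ≤ 1) (hγ : ∀ t v, ‖γ t v‖ ≤ 1)
    (a : J → Option V) (t : J → T) (w : List ((H →L[ℂ] H) × J)) (x : H) :
    ‖word B C γ a t w x‖ ≤ (w.map fun p => ‖p.1‖).prod * ‖x‖ := by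
  induction w generalizing x with
  | nil => simp [word]
  | cons p w ih =>
    obtain ⟨A, j⟩ := p
    have hl : ‖letter B C γ a t (w.map Prod.snd) j‖ ≤ 1 := by
      unfold letter
      split_ifs
      · exact hC _
      · cases a j with
        | none => exact hB _
        | some v =>
          rw [Option.elim_some, norm_smul]
          exact mul_le_one₀ (hγ _ _) (norm_nonneg _) (hB _)
    have hp : 0 ≤ (w.map fun p => ‖p.1‖).prod :=
      List.prod_nonneg (by
      rintro _ h
      obtain ⟨p, -, rfl⟩ := List.mem_map.1 h
      exact norm_nonneg _)
    simp only [word, mul_apply_eq_comp, List.map_cons, List.prod_cons]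
    refine (ih _).trans ?_
    rw [mul_comm ‖A‖, mul_assoc]
    refine mul_le_mul_of_nonneg_left ?_ hp
    refine (A.le_opNorm _).trans (mul_le_mul_of_nonneg_left ?_ (norm_nonneg _))
    exact ((letter B C γ a t _ j).le_opNorm x).trans
      ((mul_le_mul_of_nonneg_right hl (norm_nonneg _)).trans_eq (one_mul _))

theorem word_update_of_notMem {a : J → Option V} {j : J} {w : List ((H →L[ℂ] H) × J)}
    (hj : j ∉ w.map Prod.snd) (o : Option V) (t : J → T) :
    word B C γ (Function.update a j o) t w = word B C γ a t w := by
  induction w with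
  | nil => rfl
  | cons p w ih =>
    obtain ⟨A, l⟩ := p
    simp only [List.map_cons, List.mem_cons, not_or] at hj
    simp only [word, letter]
    rw [ih hj.2, Function.update_of_ne (Ne.symm hj.1)]

/-- The single place of `j` has no `j` to its left, so it is a left place, where the scalar is
attached. -/
theorem word_update_some {a : J → Option V} {j : J} {w : List ((H →L[ℂ] H) × J)}
    (hj : (w.map Prod.snd).count j = 1) (ha : a j = none) (v : V) (t : J → T) :
    word B C γ (Function.update a j (some v)) t w = γ (t j) v • word B C γ a t w := by
  induction w with
  | nil => simp at hj
  | cons p w ih =>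
    obtain ⟨A, l⟩ := p
    simp only [word, letter]
    by_cases hl : l = j
    · subst hl
      have hn : l ∉ w.map Prod.snd := by
        simpa only [List.map_cons, List.count_cons_self, Nat.add_eq_right,
          List.count_eq_zero] using hj
      rw [word_update_of_notMem hn, if_neg hn, if_neg hn, ha]
      simp
    · rw [List.map_cons, List.count_cons_of_ne hl] at hj
      rw [ih hj, Function.update_of_ne hl, smul_mul_assoc]

end Words

/-! ### Strong convergence of averaged words -/

/-- A net of averages of `B t ⊗ C t`, where `B t` and `C t` are contractions, `C t` acts as a
scalar `γ t v` on each of the subspaces `X v`, and the averages of `γ t v • B t` converge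
strongly. -/
structure PairedAverages {H : Type*} [NormedAddCommGroup H] [InnerProductSpace ℂ H] {V : Type*}
    (X : V → Submodule ℂ H) {ι : Type*} (l : Filter ι) where
  /-- the index sets of the averages -/
  T : ι → Type
  fintype : ∀ i, Fintype (T i)
  nonempty : ∀ i, Nonempty (T i)
  /-- the operators at the left places -/
  B : ∀ i, T i → H →L[ℂ] H
  /-- the operators at the right places -/
  C : ∀ i, T i → H →L[ℂ] H
  /-- the values of `C` -/
  γ : ∀ i, T i → V → ℂ
  norm_B_le : ∀ i t, ‖B i t‖ ≤ 1
  norm_C_le : ∀ i t, ‖C i t‖ ≤ 1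
  norm_γ_le : ∀ i t v, ‖γ i t v‖ ≤ 1
  C_apply : ∀ i t v, ∀ x ∈ X v, C i t x = γ i t v • x
  exists_tendsto : ∀ v x, ∃ y, Tendsto (fun i => avg fun t => γ i t v • B i t x) l (𝓝 y)

attribute [instance] PairedAverages.fintype PairedAverages.nonempty

namespace PairedAverages

variable {H : Type*} [NormedAddCommGroup H] [InnerProductSpace ℂ H] {V : Type*}
  {X : V → Submodule ℂ H} {ι : Type*} {l : Filter ι} {J : Type*} [DecidableEq J] [Fintype J]

/-- The average of a word. -/
noncomputable def mean (D : PairedAverages X l) (a : J → Option V) (w : List ((H →L[ℂ] H) × J))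
    (i : ι) (x : H) : H :=
  avg fun t : J → D.T i => word (D.B i) (D.C i) (D.γ i) a t w x

theorem norm_mean_le (D : PairedAverages X l) (a : J → Option V) (w : List ((H →L[ℂ] H) × J))
    (i : ι) (x : H) : ‖D.mean a w i x‖ ≤ (w.map fun p => ‖p.1‖).prod * ‖x‖ :=
  norm_avg_le fun t => norm_word_apply_le (D.norm_B_le i) (D.norm_C_le i) (D.norm_γ_le i) a t w x

theorem mean_add (D : PairedAverages X l) (a : J → Option V) (w : List ((H →L[ℂ] H) × J))
    (i : ι) (x y : H) : D.mean a w i (x + y) = D.mean a w i x + D.mean a w i y := by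
  simp only [mean, map_add, avg_add]

theorem mean_sub (D : PairedAverages X l) (a : J → Option V) (w : List ((H →L[ℂ] H) × J))
    (i : ι) (x y : H) : D.mean a w i (x - y) = D.mean a w i x - D.mean a w i y := by
  simp only [mean, map_sub, avg_sub]

theorem mean_smul (D : PairedAverages X l) (a : J → Option V) (w : List ((H →L[ℂ] H) × J))
    (i : ι) (c : ℂ) (x : H) : D.mean a w i (c • x) = c • D.mean a w i x := by
  simp only [mean, map_smul, avg_smul]

/-- If the last letter does not occur elsewhere, it can be averaged independently. -/
theorem mean_cons_of_notMem (D : PairedAverages X l) {a : J → Option V} {A : H →L[ℂ] H} {j : J}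
    {w : List ((H →L[ℂ] H) × J)} (hj : j ∉ w.map Prod.snd) {v : V} (ha : a j = some v) (i : ι)
    (x : H) : D.mean a ((A, j) :: w) i x =
      D.mean a w i (A (avg fun t => D.γ i t v • D.B i t x)) := by
  rw [mean, avg_update j, mean]
  congr 1
  funext t
  rw [map_avg, map_avg]
  congr 1
  funext s
  have : word (D.B i) (D.C i) (D.γ i) a (Function.update t j s) w =
      word (D.B i) (D.C i) (D.γ i) a t w :=
    word_congr fun l hl => Function.update_of_ne (fun h => hj (by rwa [h] at hl)) _ _
  simp [word, letter, this, hj, ha]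

/-- If the last letter has another place, it acts as a scalar on `X v`. -/
theorem mean_cons_of_mem (D : PairedAverages X l) {a : J → Option V} {A : H →L[ℂ] H} {j : J}
    {w : List ((H →L[ℂ] H) × J)} (hj : (w.map Prod.snd).count j = 1) (ha : a j = none) {v : V}
    (i : ι) {x : H} (hx : x ∈ X v) : D.mean a ((A, j) :: w) i x =
      D.mean (Function.update a j (some v)) w i (A x) := by
  have hm : j ∈ w.map Prod.snd := List.count_pos_iff.1 (by omega)
  rw [mean, mean]
  congr 1
  funext t
  rw [word_update_some hj ha]
  simp only [word, letter, if_pos hm, mul_apply_eq_comp, D.C_apply i _ v x hx, map_smul,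
    smul_apply]

/-- The vectors at which the averages of a word converge form a closed subspace. -/
theorem exists_tendsto_mean_of_dense [CompleteSpace H] [l.NeBot]
    (hX : (⨆ v, X v).topologicalClosure = ⊤) (D : PairedAverages X l) (a : J → Option V)
    (w : List ((H →L[ℂ] H) × J))
    (h : ∀ v, ∀ x ∈ X v, ∃ y, Tendsto (fun i => D.mean a w i x) l (𝓝 y)) (x : H) :
    ∃ y, Tendsto (fun i => D.mean a w i x) l (𝓝 y) := by
  let K : Submodule ℂ H :=
    { carrier := {x | ∃ y, Tendsto (fun i => D.mean a w i x) l (𝓝 y)}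
      add_mem' := by
        rintro x x' ⟨y, hy⟩ ⟨y', hy'⟩
        exact ⟨y + y', by simpa only [mean_add] using hy.add hy'⟩
      zero_mem' := ⟨0, by simp [mean, avg]⟩
      smul_mem' := by
        rintro c x ⟨y, hy⟩
        exact ⟨c • y, by simpa only [mean_smul] using hy.const_smul c⟩ }
  have hsup : ⨆ v, X v ≤ K := iSup_le fun v x hx => h v x hx
  set R := (w.map fun p => ‖p.1‖).prod with hR
  have hR0 : 0 ≤ R := List.prod_nonneg (by
      rintro _ h
      obtain ⟨p, -, rfl⟩ := List.mem_map.1 h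
      exact norm_nonneg _)
  have hxc : x ∈ closure ((⨆ v, X v : Submodule ℂ H) : Set H) := by
    rw [← Submodule.topologicalClosure_coe, hX]
    trivial
  -- An approximation of `x` from the span moves all means by at most `ε / 4`, uniformly in the
  -- index; this gives the Cauchy property.
  rw [← cauchy_map_iff_exists_tendsto, Metric.cauchy_iff]
  refine ⟨inferInstance, fun ε hε => ?_⟩
  obtain ⟨x', hx', hd⟩ := Metric.mem_closure_iff.1 hxc (ε / (4 * (R + 1))) (by positivity)
  obtain ⟨y, hy⟩ := hsup hx'
  have hclose : ∀ i, dist (D.mean a w i x) (D.mean a w i x') ≤ ε / 4 := by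
    intro i
    rw [dist_eq_norm, ← mean_sub]
    refine (D.norm_mean_le a w i _).trans ?_
    rw [← dist_eq_norm]
    calc R * dist x x' ≤ (R + 1) * (ε / (4 * (R + 1))) := by gcongr; linarith
      _ = ε / 4 := by field_simp
  refine ⟨(fun i => D.mean a w i x) '' {i | dist (D.mean a w i x') y < ε / 4},
    image_mem_map (Metric.tendsto_nhds.1 hy (ε / 4) (by positivity)), ?_⟩
  rintro _ ⟨i, hi, rfl⟩ _ ⟨i', hi', rfl⟩
  have h1 := dist_triangle4 (D.mean a w i x) (D.mean a w i x') (D.mean a w i' x')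
    (D.mean a w i' x)
  have h2 := dist_triangle_right (D.mean a w i x') (D.mean a w i' x') y
  have h3 := hclose i
  have h4 := hclose i'
  rw [dist_comm] at h4
  simp only [Set.mem_ofPred_eq] at hi hi'
  linarith

/-- The averages of a word converge strongly if each letter which is not replaced by a scalar has
two places, and each other letter at most one. -/
theorem exists_tendsto_mean [CompleteSpace H] [l.NeBot]
    (hX : (⨆ v, X v).topologicalClosure = ⊤) (D : PairedAverages X l)
    (w : List ((H →L[ℂ] H) × J)) (a : J → Option V)
    (ha : ∀ j, (a j = none → (w.map Prod.snd).count j = 2) ∧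
      ((a j).isSome → (w.map Prod.snd).count j ≤ 1)) (x : H) :
    ∃ y, Tendsto (fun i => D.mean a w i x) l (𝓝 y) := by
  induction w generalizing a x with
  | nil => exact ⟨x, by simp [mean, word, avg_const]⟩
  | cons p w ih =>
    obtain ⟨A, j⟩ := p
    cases haj : a j with
    | some v =>
      have hcount : (w.map Prod.snd).count j = 0 := by
        have := (ha j).2 (by simp [haj])
        rw [List.map_cons, List.count_cons_self] at this
        omega
      obtain ⟨z, hz⟩ := D.exists_tendsto v x
      obtain ⟨y, hy⟩ := ih a (fun j' => by
        by_cases hj : j' = j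
        · subst hj
          simp [haj, hcount]
        · simpa [List.count_cons_of_ne (Ne.symm hj)] using ha j') (A z)
      refine ⟨y, ?_⟩
      simp only [D.mean_cons_of_notMem (List.count_eq_zero.1 hcount) haj]
      -- The uniform bound on the means of `w` allows the averaged argument to be replaced by its
      -- limit.
      have h0 : Tendsto (fun i => D.mean a w i (A (avg fun t => D.γ i t v • D.B i t x)) -
          D.mean a w i (A z)) l (𝓝 0) := by
        simp only [← mean_sub]
        refine squeeze_zero_norm (fun i => D.norm_mean_le a w i _) ?_
        have : Tendsto (fun i => A (avg fun t => D.γ i t v • D.B i t x) - A z) l (𝓝 0) := by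
          simpa using ((A.continuous.tendsto z).comp hz).sub_const (A z)
        simpa using this.norm.const_mul ((w.map fun p => ‖p.1‖).prod)
      simpa using h0.add hy
    | none =>
      have hcount : (w.map Prod.snd).count j = 1 := by
        have := (ha j).1 haj
        rw [List.map_cons, List.count_cons_self] at this
        omega
      -- It suffices to take `x` in some `X v`: the right place of `j` then turns into a scalar, and
      -- `j` keeps one place, marked `some v`.
      refine D.exists_tendsto_mean_of_dense hX a _ (fun v x hx => ?_) x
      simp only [D.mean_cons_of_mem hcount haj _ hx]
      refine ih _ (fun j' => ?_) _
      by_cases hj : j' = j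
      · subst hj
        simp [hcount]
      · simpa [List.count_cons_of_ne (Ne.symm hj), Function.update_of_ne hj] using ha j'

end PairedAverages

/-! ### Alternating products as words -/

section Products

/-- The free factor `b` is what lets the induction run: after the first step its role is taken by `A
0`. -/
theorem mul_altProd {R : Type*} [Monoid R] (m : ℕ) (b : R) (P : Fin (m + 1) → R) (A : Fin m → R) :
    b * altProd (m + 1) P A =
      (List.ofFn fun i => (Fin.cons b A : Fin (m + 1) → R) i * P i).prod := by
  induction m generalizing b with
  | zero => simp [altProd]
  | succ m ih =>
    rw [List.ofFn_succ, List.prod_cons]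
    have := ih (A 0) (fun i => P i.succ) (fun i => A i.succ)
    rw [altProd, mul_assoc, this, ← mul_assoc]
    simp only [Fin.cons_zero, Fin.cons_succ]
    congr 4
    funext i
    congr 1
    exact (congrFun (Fin.cons_self_tail A) i : _)

/-- The alternating product in terms of a plain product. -/
theorem exists_altProd_eq_prod {R : Type*} [Monoid R] (m : ℕ) (A : Fin (m - 1) → R) :
    ∃ A' : Fin m → R, ∀ P, altProd m P A = (List.ofFn fun i => A' i * P i).prod := by
  cases m with
  | zero => exact ⟨fun _ => 1, fun P => by simp [altProd]⟩
  | succ m => exact ⟨Fin.cons 1 A, fun P => by rw [← mul_altProd, one_mul]⟩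

-- Since words are listed from the right, the last index is the head of the reversed list, and
-- occurrence in the tail means occurrence at a smaller index.
open Classical in
theorem word_ofFn {H : Type*} [NormedAddCommGroup H] [InnerProductSpace ℂ H]
    {J T V : Type*} [DecidableEq J] (B C : T → H →L[ℂ] H) (γ : T → V → ℂ) (t : J → T) {m : ℕ} (A : Fin m → H →L[ℂ] H)
    (α : Fin m → J) :
    word B C γ (fun _ => none) t (List.ofFn fun i => (A i, α i)).reverse =
      (List.ofFn fun i =>
        A i * if ∃ i' < i, α i' = α i then C (t (α i)) else B (t (α i))).prod := by
  induction m with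
  | zero => simp [word]
  | succ m ih =>
    rw [List.ofFn_succ', List.ofFn_succ', List.concat_eq_append, List.concat_eq_append,
      List.reverse_append, List.prod_append]
    simp only [List.reverse_cons, List.reverse_nil, List.nil_append, List.cons_append, word]
    rw [ih]
    congr 1
    · congr 2
      funext i
      have : (∃ i' < i.castSucc, α i' = α i.castSucc) ↔
          ∃ i' < i, α i'.castSucc = α i.castSucc :=
        ⟨fun ⟨i', h, h'⟩ => ⟨i'.castLT (lt_of_lt_of_le h (Nat.le_of_lt i.2)), h, h'⟩,
          fun ⟨i', h, h'⟩ => ⟨i'.castSucc, h, h'⟩⟩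
      simp only [this]
    · have : α (Fin.last m) ∈
          ((List.ofFn fun i : Fin m => (A i.castSucc, α i.castSucc)).reverse).map Prod.snd ↔
          ∃ i' < Fin.last m, α i' = α (Fin.last m) := by
        simp only [List.map_reverse, List.mem_reverse, List.map_ofFn, List.mem_ofFn,
          Function.comp]
        exact ⟨fun ⟨i, hi⟩ => ⟨i.castSucc, i.castSucc_lt_last, hi⟩,
          fun ⟨i, hi, h⟩ => ⟨i.castLT hi, h⟩⟩
      simp only [letter, this, List.prod_singleton, Option.elim_none]

theorem count_letters_ofFn {S J : Type*} [DecidableEq J] {m : ℕ} (A : Fin m → S) (α : Fin m → J)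
    (j : J) : ((List.ofFn fun i => (A i, α i)).reverse.map Prod.snd).count j =
      (Finset.univ.filter fun i => α i = j).card := by
  rw [List.map_reverse, List.count_reverse, List.map_ofFn, List.ofFn_eq_map, List.count_eq_countP,
    List.countP_map, Finset.card_def, Finset.filter_val, ← Multiset.countP_eq_card_filter]
  simp only [Fin.univ_def, Function.comp_def, Multiset.coe_countP]
  rfl

end Products

/-! ### Pair-partitions and orthonormal weights -/

section Weights

variable {k m : ℕ}

theorem avg_prod {k : ℕ} {T : Type*} [Fintype T] (f : Fin k → T → ℂ) :
    (avg fun t : Fin k → T => ∏ j, f j (t j)) = ∏ j, avg (f j) := by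
  simp only [avg, smul_eq_mul, Finset.prod_mul_distrib]
  rw [Finset.prod_univ_sum, Fintype.piFinset_univ]
  simp

/-- In a part of a pair-partition, there is a first and a second place. -/
theorem exists_pair {α : Fin m → Fin k}
    (hα : ∀ j, (Finset.univ.filter fun i => α i = j).card = 2) (j : Fin k) :
    ∃ p q, p < q ∧ (Finset.univ.filter fun i => α i = j) = {p, q} ∧
      (¬ ∃ i' < p, α i' = α p) ∧ ∃ i' < q, α i' = α q := by
  obtain ⟨p, q, hne, he⟩ := Finset.card_eq_two.1 (hα j)
  wlog hlt : p < q generalizing p q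
  · exact this q p hne.symm (by rw [he, Finset.pair_comm])
      (lt_of_le_of_ne (not_lt.1 hlt) hne.symm)
  have hmem : ∀ i, α i = j ↔ i = p ∨ i = q := fun i => by
    have : i ∈ Finset.univ.filter (fun i => α i = j) ↔ i ∈ ({p, q} : Finset (Fin m)) := by rw [he]
    simpa using this
  have hp : α p = j := (hmem p).2 (Or.inl rfl)
  have hq : α q = j := (hmem q).2 (Or.inr rfl)
  refine ⟨p, q, hlt, he, ?_, p, hlt, hp.trans hq.symm⟩
  rintro ⟨i, hi, h⟩
  rcases (hmem i).1 (h.trans hp) with rfl | rfl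
  · exact lt_irrefl _ hi
  · exact lt_asymm hi hlt

open Classical in
/-- Let the functions `χ · z` be orthonormal for `z ∈ F`. A sum of products over the pair-partition
is the average of the products of the corresponding sums at the individual places. -/
theorem avg_prod_sum_eq {H : Type*} [NormedAddCommGroup H] [InnerProductSpace ℂ H] {T Z : Type*}
    [Fintype T] {α : Fin m → Fin k}
    (hα : ∀ j, (Finset.univ.filter fun i => α i = j).card = 2) (F : Finset Z) (χ : T → Z → ℂ)
    (hχ : ∀ z ∈ F, ∀ w ∈ F, (avg fun t => χ t z * star (χ t w)) = if z = w then 1 else 0)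
    (A : Fin m → H →L[ℂ] H) (P Q : Z → H →L[ℂ] H) :
    (avg fun t : Fin k → T => (List.ofFn fun i =>
      A i * if ∃ i' < i, α i' = α i then ∑ z ∈ F, star (χ (t (α i)) z) • Q z
        else ∑ z ∈ F, χ (t (α i)) z • P z).prod) =
    ∑ z ∈ Fintype.piFinset fun _ : Fin k => F, (List.ofFn fun i =>
      A i * if ∃ i' < i, α i' = α i then Q (z (α i)) else P (z (α i))).prod := by
  let c : Fin m → T → Z → ℂ := fun i t z =>
    if ∃ i' < i, α i' = α i then star (χ t z) else χ t z
  let G : Fin m → Z → H →L[ℂ] H := fun i z => if ∃ i' < i, α i' = α i then Q z else P z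
  let W : (Fin m → Z) → ℂ := fun ρ => avg fun t : Fin k → T => ∏ i, c i (t (α i)) (ρ i)
  have hexp : ∀ t : Fin k → T, (List.ofFn fun i =>
      A i * if ∃ i' < i, α i' = α i then ∑ z ∈ F, star (χ (t (α i)) z) • Q z
        else ∑ z ∈ F, χ (t (α i)) z • P z).prod =
      ∑ ρ ∈ Fintype.piFinset fun _ : Fin m => F,
        (∏ i, c i (t (α i)) (ρ i)) • (List.ofFn fun i => A i * G i (ρ i)).prod := by
    intro t
    have h1 : (fun i => A i * if ∃ i' < i, α i' = α i then ∑ z ∈ F, star (χ (t (α i)) z) • Q z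
        else ∑ z ∈ F, χ (t (α i)) z • P z) =
        fun i => ∑ z ∈ F, c i (t (α i)) z • (A i * G i z) := by
      funext i
      simp only [c, G]
      split_ifs <;> simp [Finset.mul_sum]
    rw [h1, ← MultilinearMap.mkPiAlgebraFin_apply (R := ℂ), MultilinearMap.map_sum_finset]
    refine Finset.sum_congr rfl fun ρ _ => ?_
    rw [MultilinearMap.map_smul_univ, MultilinearMap.mkPiAlgebraFin_apply]
  -- The weight factors over the parts; on each part orthonormality gives one or zero, according to
  -- whether `ρ` agrees at the two places.
  have hW : ∀ ρ : Fin m → Z, (∀ i, ρ i ∈ F) → W ρ =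
      ∏ j, if ∀ i i', α i = j → α i' = j → ρ i = ρ i' then 1 else 0 := by
    intro ρ hρ
    have h1 : ∀ t : Fin k → T, ∏ i, c i (t (α i)) (ρ i) =
        ∏ j, ∏ i ∈ Finset.univ.filter (fun i => α i = j), c i (t j) (ρ i) := by
      intro t
      rw [← Finset.prod_fiberwise Finset.univ α]
      refine Finset.prod_congr rfl fun j _ => Finset.prod_congr rfl fun i hi => ?_
      rw [(Finset.mem_filter.1 hi).2]
    simp only [W, h1]
    rw [avg_prod fun j s => ∏ i ∈ Finset.univ.filter (fun i => α i = j), c i s (ρ i)]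
    refine Finset.prod_congr rfl fun j _ => ?_
    obtain ⟨p, q, hlt, he, hp, hq⟩ := exists_pair hα j
    have hmem : ∀ i, α i = j ↔ i = p ∨ i = q := fun i => by
      have : i ∈ Finset.univ.filter (fun i => α i = j) ↔ i ∈ ({p, q} : Finset (Fin m)) := by
        rw [he]
      simpa using this
    have h2 : ∀ s, ∏ i ∈ Finset.univ.filter (fun i => α i = j), c i s (ρ i) =
        χ s (ρ p) * star (χ s (ρ q)) := by
      intro s
      rw [he, Finset.prod_pair hlt.ne]
      simp only [c, if_neg hp, if_pos hq]
    simp only [h2]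
    rw [hχ _ (hρ p) _ (hρ q)]
    refine if_congr ⟨fun h i i' hi hi' => ?_, fun h => h p q ((hmem p).2 (Or.inl rfl))
      ((hmem q).2 (Or.inr rfl))⟩ rfl rfl
    rcases (hmem i).1 hi with rfl | rfl <;> rcases (hmem i').1 hi' with rfl | rfl <;> simp [h]
  have hsurj : Function.Surjective α := fun j => by
    obtain ⟨p, q, -, he, -⟩ := exists_pair hα j
    exact ⟨p, (Finset.mem_filter.1 (he ▸ Finset.mem_insert_self p {q} :
      p ∈ Finset.univ.filter fun i => α i = j)).2⟩
  simp only [hexp]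
  have hswap : (avg fun t : Fin k → T => ∑ ρ ∈ Fintype.piFinset fun _ : Fin m => F,
      (∏ i, c i (t (α i)) (ρ i)) • (List.ofFn fun i => A i * G i (ρ i)).prod) =
      ∑ ρ ∈ Fintype.piFinset fun _ : Fin m => F,
        W ρ • (List.ofFn fun i => A i * G i (ρ i)).prod := by
    simp only [avg, W]
    rw [Finset.sum_comm, Finset.smul_sum]
    refine Finset.sum_congr rfl fun ρ _ => ?_
    rw [← Finset.sum_smul, smul_assoc]
  rw [hswap]
  -- The surviving `ρ` are those constant on the parts, that is, those of the form `z ∘ α`.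
  symm
  refine Finset.sum_of_injOn (fun z => z ∘ α) (hsurj.injective_comp_right.injOn) ?_ ?_ ?_
  · intro z hz
    simp only [Finset.mem_coe, Fintype.mem_piFinset] at hz ⊢
    exact fun i => hz _
  · intro ρ hρ hnot
    rw [Fintype.mem_piFinset] at hρ
    have : W ρ = 0 := by
      rw [hW ρ hρ]
      by_contra hne
      have hall := fun j => Finset.prod_ne_zero_iff.1 hne j (Finset.mem_univ j)
      simp only [ne_eq, ite_eq_right_iff, one_ne_zero, imp_false, not_not] at hall
      obtain ⟨s, hs⟩ := hsurj.hasRightInverse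
      refine hnot ⟨ρ ∘ s, ?_, funext fun i => hall (α i) _ _ (hs _) rfl⟩
      simp only [Finset.mem_coe, Fintype.mem_piFinset]
      exact fun j => hρ _
    rw [this, zero_smul]
  · intro z hz
    rw [Fintype.mem_piFinset] at hz
    have : W (z ∘ α) = 1 := by
      rw [hW (z ∘ α) fun i => hz _]
      refine Finset.prod_eq_one fun j _ => if_pos fun i i' hi hi' => ?_
      simp [hi, hi']
    rw [this, one_smul]
    rfl

end Weights

/-! ### Eigenspaces and eigenprojections of a unitary -/

section Projections

open scoped ComplexConjugate

variable {H : Type*} [NormedAddCommGroup H] [InnerProductSpace ℂ H] [CompleteSpace H]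

local notation "⟪" x ", " y "⟫" => inner ℂ x y

/-- The eigenspace of `U` for `v`. -/
abbrev eigspace (U : unitary (H →L[ℂ] H)) (v : ℂ) : Submodule ℂ H :=
  Module.End.eigenspace ((U : H →L[ℂ] H) : H →ₗ[ℂ] H) v

theorem mem_eigspace {U : unitary (H →L[ℂ] H)} {v : ℂ} {x : H} :
    x ∈ eigspace U v ↔ (U : H →L[ℂ] H) x = v • x := Module.End.mem_eigenspace_iff

theorem inner_eq_zero_of_mem_eigspace {U : unitary (H →L[ℂ] H)} {v w : ℂ} (hv : ‖v‖ = 1)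
    (hne : v ≠ w) {x y : H} (hx : x ∈ eigspace U v) (hy : y ∈ eigspace U w) : ⟪x, y⟫ = 0 := by
  rw [mem_eigspace] at hx hy
  have h := inner_map_map U x y
  rw [hx, hy, inner_smul_left, inner_smul_right, ← mul_assoc] at h
  by_contra h0
  have h1 : conj v * w = 1 := mul_right_cancel₀ h0 (by rw [h, one_mul])
  refine hne ?_
  calc v = v * (conj v * w) := by rw [h1, mul_one]
    _ = w := by rw [← mul_assoc, Complex.mul_conj', hv]; simp

theorem orthogonalFamily_eigspace (U : unitary (H →L[ℂ] H)) :
    OrthogonalFamily ℂ (fun v : sigmaPP U => eigspace U v)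
      fun v => (eigspace U v).subtypeₗᵢ := fun v _ hne x y =>
  inner_eq_zero_of_mem_eigspace (norm_eq_one_of_mem_sigmaPP v.2)
    (fun h => hne (Subtype.ext h)) x.2 y.2

theorem eigenProj_apply_of_mem {U : unitary (H →L[ℂ] H)} {v w : ℂ} (hv : ‖v‖ = 1) {x : H}
    (hx : x ∈ eigspace U v) : eigenProj U w x = if w = v then x else 0 := by
  split_ifs with h
  · subst h
    exact Submodule.starProjection_eq_self_iff.2 hx
  · refine (Submodule.starProjection_apply_eq_zero_iff _).2 ?_
    rw [Submodule.mem_orthogonal']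
    exact fun y hy => inner_eq_zero_of_mem_eigspace hv (Ne.symm h) hx hy

theorem eigenProj_apply_mem (U : unitary (H →L[ℂ] H)) (v : ℂ) (x : H) :
    eigenProj U v x ∈ eigspace U v := Submodule.starProjection_apply_mem _ _

theorem eigenProj_eq_zero {U : unitary (H →L[ℂ] H)} {v : ℂ} (hv : v ∉ sigmaPP U) :
    eigenProj U v = 0 := by
  have h : eigspace U v = ⊥ := not_not.1 hv
  ext x
  have := eigenProj_apply_mem U v x
  rw [h, Submodule.mem_bot] at this
  simpa using this

/-- By orthogonality of the eigenspaces, coefficients of modulus at most one do not exceed the norm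
of `y = ∑ E x`, and `‖y‖ ^ 2 = ⟪y, x⟫` bounds `‖y‖` by `‖x‖`. -/
theorem norm_sum_smul_eigenProj_le (U : unitary (H →L[ℂ] H)) {Z : Type*} {f : Z → sigmaPP U}
    (hf : Function.Injective f) {c : Z → ℂ} (hc : ∀ z, ‖c z‖ ≤ 1) (F : Finset Z) :
    ‖∑ z ∈ F, c z • eigenProj U (f z)‖ ≤ 1 := by
  refine ContinuousLinearMap.opNorm_le_bound _ zero_le_one fun x => ?_
  rw [one_mul]
  let p : ∀ z, eigspace U (f z) := fun z => ⟨eigenProj U (f z) x, eigenProj_apply_mem U _ x⟩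
  have hsq : ∀ b : Z → ℂ, ‖∑ z ∈ F, b z • eigenProj U (f z) x‖ ^ 2 =
      ∑ z ∈ F, ‖b z • eigenProj U (f z) x‖ ^ 2 := fun b =>
    ((orthogonalFamily_eigspace U).comp hf).norm_sum (fun z => b z • p z) F
  set y := ∑ z ∈ F, eigenProj U (f z) x with hy
  have hy2 : ‖y‖ ^ 2 = ∑ z ∈ F, ‖eigenProj U (f z) x‖ ^ 2 := by
    simpa [hy] using hsq fun _ => 1
  have hyx : ‖y‖ ≤ ‖x‖ := by
    have h1 : ⟪y, x⟫ = ((‖y‖ ^ 2 : ℝ) : ℂ) := by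
      rw [hy2, hy, sum_inner]
      push_cast
      refine Finset.sum_congr rfl fun z _ => ?_
      have := Submodule.inner_orthogonalProjectionOnto_eq_of_mem_left (K := eigspace U (f z))
        (p z) x
      exact this.symm.trans (inner_self_eq_norm_sq_to_K (𝕜 := ℂ) (eigenProj U (f z) x))
    have h2 := norm_inner_le_norm (𝕜 := ℂ) y x
    rw [h1, Complex.norm_real, Real.norm_of_nonneg (by positivity)] at h2
    by_contra hlt
    push Not at hlt
    nlinarith [norm_nonneg y, norm_nonneg x]
  refine le_trans ?_ hyx
  have hle : ‖∑ z ∈ F, c z • eigenProj U (f z) x‖ ^ 2 ≤ ‖y‖ ^ 2 := by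
    rw [hsq, hy2]
    refine Finset.sum_le_sum fun z _ => ?_
    rw [norm_smul]
    have := mul_le_mul_of_nonneg_right (hc z) (norm_nonneg (eigenProj U (f z) x))
    rw [one_mul] at this
    gcongr
  simpa using abs_le_of_sq_le_sq hle (norm_nonneg y)

theorem conj_mem_sigmaPP {U : unitary (H →L[ℂ] H)} (z : sigmaPPa U) :
    star (z : ℂ) ∈ sigmaPP U := by
  obtain ⟨w, hw, h⟩ := z.2.2
  have hz := norm_eq_one_of_mem_sigmaPP z.2.1
  have : star (z : ℂ) = w := by
    calc star (z : ℂ) = star (z : ℂ) * (z * w) := by rw [h, mul_one]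
      _ = w := by
        rw [← mul_assoc, Complex.star_def, Complex.conj_mul', hz]; simp
  rwa [this]

theorem mem_sigmaPPa_of_conj {U : unitary (H →L[ℂ] H)} {v : ℂ} (hv : v ∈ sigmaPP U)
    (hv' : star v ∈ sigmaPP U) : star v ∈ sigmaPPa U :=
  ⟨hv', v, hv, by
    rw [Complex.star_def, Complex.conj_mul', norm_eq_one_of_mem_sigmaPP hv]; simp⟩

end Projections

/-! ### The Cesàro means -/

section MeanNet

variable {H : Type*} [NormedAddCommGroup H] [InnerProductSpace ℂ H] [CompleteSpace H]

theorem pow_apply_of_mem_eigspace {U : unitary (H →L[ℂ] H)} {v : ℂ} {x : H}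
    (hx : x ∈ eigspace U v) (n : ℕ) : ((U : H →L[ℂ] H) ^ n) x = v ^ n • x := by
  induction n with
  | zero => simp
  | succ n ih =>
    rw [pow_succ', mul_apply_eq_comp, ih, map_smul, mem_eigspace.1 hx, smul_smul, pow_succ]

/-- The mean ergodic theorem for `v • U`. -/
theorem tendsto_avg_pow (U : unitary (H →L[ℂ] H)) {v : ℂ} (hv : ‖v‖ = 1) (x : H) :
    Tendsto (fun N : ℕ => avg fun t : Fin (N + 1) => v ^ (t : ℕ) • ((U : H →L[ℂ] H) ^ (t : ℕ)) x)
      atTop (𝓝 (eigenProj U (star v) x)) := by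
  set f : H →L[ℂ] H := v • (U : H →L[ℂ] H) with hf
  have hnorm : ‖f‖ ≤ 1 := ContinuousLinearMap.opNorm_le_bound _ zero_le_one fun y => by
    rw [hf, smul_apply, norm_smul, hv, norm_map]
  have h := (f.tendsto_birkhoffAverage_orthogonalProjection hnorm x).comp (tendsto_add_atTop_nat 1)
  have hstar : star v * v = 1 := by rw [Complex.star_def, Complex.conj_mul', hv]; simp
  -- As `v` is unimodular, the fixed vectors of `v • U` are the eigenvectors of `U` for `conj v`.
  have hfix : f.eqLocus (1 : H →L[ℂ] H) = eigspace U (star v) := by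
    ext y
    rw [mem_eigspace, LinearMap.mem_eqLocus]
    simp only [hf]
    constructor
    · intro h
      replace h : v • (U : H →L[ℂ] H) y = y := h
      rw [← one_smul ℂ ((U : H →L[ℂ] H) y), ← hstar, mul_smul, h]
    · intro h
      change v • (U : H →L[ℂ] H) y = y
      rw [h, smul_smul, mul_comm, hstar, one_smul]
  have hit : ∀ n, f^[n] x = v ^ n • ((U : H →L[ℂ] H) ^ n) x := by
    intro n
    rw [← FunLike.coe_pow_eq_iterate f n, hf, smul_pow]
    rfl
  convert h using 1
  · funext N
    simp only [Function.comp, birkhoffAverage, birkhoffSum, avg, id, hit, Fintype.card_fin]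
    rw [Fin.sum_univ_eq_sum_range fun n => v ^ n • ((U : H →L[ℂ] H) ^ n) x]
  · congr 1
    have hproj : ∀ (K K' : Submodule ℂ H) [K.HasOrthogonalProjection]
        [K'.HasOrthogonalProjection], K = K' →
        (K.orthogonalProjectionOnto x : H) = K'.orthogonalProjectionOnto x := by
      rintro K _ _ _ rfl
      rfl
    exact hproj _ _ hfix.symm

/-- The Cesàro means as a net of averages. -/
noncomputable def powNet (U : unitary (H →L[ℂ] H)) :
    PairedAverages (fun v : sigmaPP U => eigspace U v) (atTop : Filter ℕ) where
  T N := Fin (N + 1)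
  fintype _ := inferInstance
  nonempty _ := inferInstance
  B _ t := (U : H →L[ℂ] H) ^ (t : ℕ)
  C _ t := (U : H →L[ℂ] H) ^ (t : ℕ)
  γ _ t v := (v : ℂ) ^ (t : ℕ)
  norm_B_le _ t := ContinuousLinearMap.opNorm_le_bound _ zero_le_one fun x => by
    rw [norm_pow_apply, one_mul]
  norm_C_le _ t := ContinuousLinearMap.opNorm_le_bound _ zero_le_one fun x => by
    rw [norm_pow_apply, one_mul]
  norm_γ_le _ t v := by rw [norm_pow, norm_eq_one_of_mem_sigmaPP v.2, one_pow]
  C_apply _ t v x hx := pow_apply_of_mem_eigspace hx t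
  exists_tendsto v x := ⟨_, tendsto_avg_pow U (norm_eq_one_of_mem_sigmaPP v.2) x⟩

end MeanNet

/-! ### Orthonormal characters of a cyclic group -/

section Characters

open scoped Classical in
/-- Characters of a cyclic group which are orthonormal on the finite set `F`. -/
noncomputable def cyclicChar {Z : Type*} (F : Finset Z) (t : ZMod (F.card + 1)) (z : Z) : ℂ :=
  ZMod.stdAddChar (t * if h : z ∈ F then ((F.equivFin ⟨z, h⟩ : ℕ) : ZMod (F.card + 1)) else 0)

theorem norm_cyclicChar {Z : Type*} (F : Finset Z) (t : ZMod (F.card + 1)) (z : Z) :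
    ‖cyclicChar F t z‖ = 1 := AddChar.norm_apply _ _

open scoped Classical in
theorem avg_cyclicChar {Z : Type*} (F : Finset Z) {z w : Z} (hz : z ∈ F) (hw : w ∈ F) :
    (avg fun t => cyclicChar F t z * star (cyclicChar F t w)) = if z = w then 1 else 0 := by
  set a : ZMod (F.card + 1) := ((F.equivFin ⟨z, hz⟩ : ℕ) : ZMod (F.card + 1)) with ha
  set b : ZMod (F.card + 1) := ((F.equivFin ⟨w, hw⟩ : ℕ) : ZMod (F.card + 1)) with hb
  have h1 : ∀ t, cyclicChar F t z * star (cyclicChar F t w) = ZMod.stdAddChar (t * (a - b)) := by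
    intro t
    rw [cyclicChar, cyclicChar, dif_pos hz, dif_pos hw, Complex.star_def,
      ← AddChar.map_neg_eq_conj, ← AddChar.map_add_eq_mul]
    congr 1
    ring
  have hab : a - b = 0 ↔ z = w := by
    rw [sub_eq_zero]
    refine ⟨fun h => ?_, fun h => by subst h; rfl⟩
    have h2 := congrArg ZMod.val h
    rw [ha, hb, ZMod.val_cast_of_lt (Nat.lt_succ_of_lt (F.equivFin ⟨z, hz⟩).2),
      ZMod.val_cast_of_lt (Nat.lt_succ_of_lt (F.equivFin ⟨w, hw⟩).2)] at h2
    have h3 := F.equivFin.injective (Fin.ext h2)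
    exact congrArg Subtype.val h3
  simp only [avg, h1, AddChar.sum_mulShift _ (ZMod.isPrimitive_stdAddChar _), hab]
  have : (Fintype.card (ZMod (F.card + 1)) : ℂ) ≠ 0 := Nat.cast_ne_zero.2 Fintype.card_ne_zero
  split_ifs
  · rw [smul_eq_mul, inv_mul_cancel₀ this]
  · simp

end Characters

/-! ### The truncations as averages of contractions -/

section TruncationNet

variable {H : Type*} [NormedAddCommGroup H] [InnerProductSpace ℂ H] [CompleteSpace H]

/-- The operator at the left places whose averages give `∑ z ∈ F, E_z ⊗ E_{conj z}`. -/
noncomputable def charLeft (U : unitary (H →L[ℂ] H)) (F : Finset (sigmaPPa U))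
    (t : ZMod (F.card + 1)) : H →L[ℂ] H :=
  ∑ z ∈ F, cyclicChar F t z • eigenProj U (z : ℂ)

/-- The operator at the right places whose averages give `∑ z ∈ F, E_z ⊗ E_{conj z}`. -/
noncomputable def charRight (U : unitary (H →L[ℂ] H)) (F : Finset (sigmaPPa U))
    (t : ZMod (F.card + 1)) : H →L[ℂ] H :=
  ∑ z ∈ F, star (cyclicChar F t z) • eigenProj U (star (z : ℂ))

open scoped Classical in
/-- The scalar by which `charRight` acts on the eigenspace for `v`. -/
noncomputable def charScalar (U : unitary (H →L[ℂ] H)) (F : Finset (sigmaPPa U))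
    (t : ZMod (F.card + 1)) (v : ℂ) : ℂ :=
  ∑ z ∈ F, if star (z : ℂ) = v then star (cyclicChar F t z) else 0

theorem charRight_apply_of_mem (U : unitary (H →L[ℂ] H)) (F : Finset (sigmaPPa U))
    (t : ZMod (F.card + 1)) {v : ℂ} (hv : ‖v‖ = 1) {x : H} (hx : x ∈ eigspace U v) :
    charRight U F t x = charScalar U F t v • x := by
  rw [charRight, charScalar, sum_apply, Finset.sum_smul]
  refine Finset.sum_congr rfl fun z _ => ?_
  rw [smul_apply, eigenProj_apply_of_mem hv hx]
  split_ifs <;> simp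

open scoped Classical in
theorem charScalar_conj (U : unitary (H →L[ℂ] H)) (F : Finset (sigmaPPa U))
    (t : ZMod (F.card + 1)) (z : sigmaPPa U) :
    charScalar U F t (star (z : ℂ)) = if z ∈ F then star (cyclicChar F t z) else 0 := by
  rw [charScalar, ← Finset.sum_ite_eq' F z fun z => star (cyclicChar F t z)]
  refine Finset.sum_congr rfl fun w _ => ?_
  simp only [star_inj, Subtype.ext_iff]

theorem charScalar_eq_zero (U : unitary (H →L[ℂ] H)) (F : Finset (sigmaPPa U))
    (t : ZMod (F.card + 1)) {v : ℂ} (hv : star v ∉ sigmaPPa U) : charScalar U F t v = 0 :=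
  Finset.sum_eq_zero fun z _ => if_neg fun h => hv (by rw [← h, star_star]; exact z.2)

/-- At most one `z ∈ F` satisfies `star z = v`, so at most one unimodular term is present. -/
theorem norm_charScalar_le (U : unitary (H →L[ℂ] H)) (F : Finset (sigmaPPa U))
    (t : ZMod (F.card + 1)) (v : ℂ) : ‖charScalar U F t v‖ ≤ 1 := by
  classical
  by_cases hv : star v ∈ sigmaPPa U
  · have h := charScalar_conj U F t ⟨star v, hv⟩
    simp only [star_star] at h
    rw [h]
    split_ifs
    · rw [norm_star, norm_cyclicChar]
    · simp
  · simp [charScalar_eq_zero U F t hv]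

/-- Orthonormality selects the term `E_{conj v}` as soon as `F` contains `conj v`. If `conj v` is
outside `sigmaPPa U`, it is not an eigenvalue, because `v * conj v = 1`; both sides then vanish.
This is why the sum over `sigmaPPa U` suffices. -/
theorem tendsto_avg_charScalar (U : unitary (H →L[ℂ] H)) {v : ℂ} (hv : v ∈ sigmaPP U) (x : H) :
    Tendsto (fun F : Finset (sigmaPPa U) =>
      avg fun t : ZMod (F.card + 1) => charScalar U F t v • charLeft U F t x)
      atTop (𝓝 (eigenProj U (star v) x)) := by
  classical
  by_cases hv' : star v ∈ sigmaPPa U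
  · set z : sigmaPPa U := ⟨star v, hv'⟩ with hz
    have hvz : v = star (z : ℂ) := by simp [hz]
    refine tendsto_const_nhds.congr' ?_
    filter_upwards [eventually_ge_atTop {z}] with F hF
    have hzF : z ∈ F := Finset.singleton_subset_iff.1 hF
    have h1 : ∀ t, charScalar U F t v • charLeft U F t x =
        ∑ w ∈ F, (cyclicChar F t w * star (cyclicChar F t z)) • eigenProj U (w : ℂ) x := by
      intro t
      rw [hvz, charScalar_conj, if_pos hzF, charLeft, sum_apply, Finset.smul_sum]
      refine Finset.sum_congr rfl fun w _ => ?_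
      rw [smul_apply, smul_smul, mul_comm]
    have h2 : (avg fun t : ZMod (F.card + 1) => charScalar U F t v • charLeft U F t x) =
        ∑ w ∈ F, (avg fun t => cyclicChar F t w * star (cyclicChar F t z)) •
          eigenProj U (w : ℂ) x := by
      simp only [h1, avg]
      rw [Finset.sum_comm, Finset.smul_sum]
      refine Finset.sum_congr rfl fun w _ => ?_
      rw [← Finset.sum_smul, smul_assoc]
    rw [h2, Finset.sum_eq_single_of_mem z hzF]
    · rw [avg_cyclicChar F hzF hzF, if_pos rfl, one_smul]
    · intro w hw hne
      rw [avg_cyclicChar F hw hzF, if_neg hne, zero_smul]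
  · have h0 : eigenProj U (star v) = 0 :=
      eigenProj_eq_zero fun h => hv' (mem_sigmaPPa_of_conj hv h)
    rw [h0]
    simp [charScalar_eq_zero U _ _ hv', avg]

/-- The truncations as a net of averages. -/
noncomputable def charNet (U : unitary (H →L[ℂ] H)) :
    PairedAverages (fun v : sigmaPP U => eigspace U v)
      (atTop : Filter (Finset (sigmaPPa U))) where
  T F := ZMod (F.card + 1)
  fintype _ := inferInstance
  nonempty _ := inferInstance
  B := charLeft U
  C := charRight U
  γ F t v := charScalar U F t v
  norm_B_le F t := norm_sum_smul_eigenProj_le U (Z := sigmaPPa U) (f := fun z => ⟨z, z.2.1⟩)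
    (fun _ _ h => Subtype.ext (congrArg (Subtype.val : sigmaPP U → ℂ) h))
    (fun z => (norm_cyclicChar F t z).le) F
  norm_C_le F t := norm_sum_smul_eigenProj_le U (Z := sigmaPPa U)
    (f := fun z => ⟨star (z : ℂ), conj_mem_sigmaPP z⟩)
    (fun _ _ h => Subtype.ext (star_injective (congrArg (Subtype.val : sigmaPP U → ℂ) h)))
    (fun z => ((norm_star _).trans (norm_cyclicChar F t z)).le) F
  norm_γ_le F t v := norm_charScalar_le U F t v
  C_apply F t v _ hx := charRight_apply_of_mem U F t (norm_eq_one_of_mem_sigmaPP v.2) hx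
  exists_tendsto v x := ⟨_, tendsto_avg_charScalar U v.2 x⟩

end TruncationNet

/-! ### Comparison of two nets -/

section Combination

variable {H : Type*} [NormedAddCommGroup H] [InnerProductSpace ℂ H] {V : Type*}
  {X : V → Submodule ℂ H} {ι₁ ι₂ : Type*} {l₁ : Filter ι₁} {l₂ : Filter ι₂}

/-- Two nets of averages whose scalar averages have the same limits form a single net. -/
def PairedAverages.sum (D₁ : PairedAverages X l₁) (D₂ : PairedAverages X l₂)
    (h : ∀ v x, ∃ y, Tendsto (fun i => avg fun t => D₁.γ i t v • D₁.B i t x) l₁ (𝓝 y) ∧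
      Tendsto (fun i => avg fun t => D₂.γ i t v • D₂.B i t x) l₂ (𝓝 y)) :
    PairedAverages X (map Sum.inl l₁ ⊔ map Sum.inr l₂) where
  T := Sum.elim D₁.T D₂.T
  fintype := Sum.rec D₁.fintype D₂.fintype
  nonempty := Sum.rec D₁.nonempty D₂.nonempty
  B := Sum.rec D₁.B D₂.B
  C := Sum.rec D₁.C D₂.C
  γ := Sum.rec D₁.γ D₂.γ
  norm_B_le := Sum.rec D₁.norm_B_le D₂.norm_B_le
  norm_C_le := Sum.rec D₁.norm_C_le D₂.norm_C_le
  norm_γ_le := Sum.rec D₁.norm_γ_le D₂.norm_γ_le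
  C_apply := Sum.rec D₁.C_apply D₂.C_apply
  exists_tendsto v x := by
    obtain ⟨y, h₁, h₂⟩ := h v x
    exact ⟨y, (tendsto_map' h₁).sup (tendsto_map' h₂)⟩

/-- The averages of a word along two nets have the same limit. -/
theorem PairedAverages.exists_tendsto_mean_both [CompleteSpace H] [l₁.NeBot]
    (hX : (⨆ v, X v).topologicalClosure = ⊤) (D₁ : PairedAverages X l₁)
    (D₂ : PairedAverages X l₂)
    (h : ∀ v x, ∃ y, Tendsto (fun i => avg fun t => D₁.γ i t v • D₁.B i t x) l₁ (𝓝 y) ∧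
      Tendsto (fun i => avg fun t => D₂.γ i t v • D₂.B i t x) l₂ (𝓝 y))
    {J : Type*} [DecidableEq J] [Fintype J] (w : List ((H →L[ℂ] H) × J))
    (hw : ∀ j, (w.map Prod.snd).count j = 2) (x : H) :
    ∃ y, Tendsto (fun i => D₁.mean (fun _ => none) w i x) l₁ (𝓝 y) ∧
      Tendsto (fun i => D₂.mean (fun _ => none) w i x) l₂ (𝓝 y) := by
  obtain ⟨y, hy⟩ := (D₁.sum D₂ h).exists_tendsto_mean hX w (fun _ => none) (by simp [hw]) x
  rw [tendsto_sup, tendsto_map'_iff, tendsto_map'_iff] at hy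
  exact ⟨y, hy.1, hy.2⟩

end Combination

/-! ### Identification of the Cesàro means and the truncations -/

section Identification

variable {H : Type*} [NormedAddCommGroup H] [InnerProductSpace ℂ H] [CompleteSpace H]

theorem entangledMean_apply_eq_mean (U : unitary (H →L[ℂ] H)) {k : ℕ} (α : Fin (2 * k) → Fin k)
    (A : Fin (2 * k - 1) → H →L[ℂ] H) {A' : Fin (2 * k) → H →L[ℂ] H}
    (hA' : ∀ P, altProd (2 * k) P A = (List.ofFn fun i => A' i * P i).prod) (N : ℕ) (x : H) :
    entangledMean U α A (N + 1) x =
      (powNet U).mean (fun _ => none) (List.ofFn fun i => (A' i, α i)).reverse N x := by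
  have hw : ∀ t : Fin k → Fin (N + 1), word ((powNet U).B N) ((powNet U).C N) ((powNet U).γ N)
      (fun _ => none) t (List.ofFn fun i => (A' i, α i)).reverse =
      altProd (2 * k) (fun i => (U : H →L[ℂ] H) ^ (t (α i) : ℕ)) A := by
    intro t
    rw [hA']
    refine (word_ofFn ((powNet U).B N) ((powNet U).C N) ((powNet U).γ N) t A' α).trans ?_
    simp only [powNet, ite_self]
  change _ = avg fun t : Fin k → Fin (N + 1) => word ((powNet U).B N) ((powNet U).C N)
    ((powNet U).γ N) (fun _ => none) t (List.ofFn fun i => (A' i, α i)).reverse x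
  simp only [hw, entangledMean, avg, smul_apply, sum_apply, Fintype.card_pi, Fintype.card_fin,
    Finset.prod_const, Finset.card_univ, Nat.cast_pow]
  congr 1
  symm
  -- The `N + 1` values in `Fin (N + 1)` are the exponents below `N + 1`; the shift keeps the index
  -- sets nonempty.
  refine Finset.sum_of_injOn (fun (t : Fin k → Fin (N + 1)) j => (t j : ℕ)) ?_ ?_ ?_ ?_
  · exact (Fin.val_injective.comp_left).injOn
  · intro t _
    simpa using fun j => Nat.le_of_lt_succ (t j).2
  · intro n hn hnot
    rw [Fintype.mem_piFinset] at hn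
    exact absurd ⟨fun j => ⟨n j, Finset.mem_range.1 (hn j)⟩, by simp, rfl⟩ hnot
  · intro t _
    rfl

theorem truncSum_apply_eq_mean (U : unitary (H →L[ℂ] H)) {k : ℕ} {α : Fin (2 * k) → Fin k}
    (hα : IsPairPartition α) (A : Fin (2 * k - 1) → H →L[ℂ] H)
    {A' : Fin (2 * k) → H →L[ℂ] H}
    (hA' : ∀ P, altProd (2 * k) P A = (List.ofFn fun i => A' i * P i).prod)
    (F : Finset (sigmaPPa U)) (x : H) :
    truncSum U α A F x =
      (charNet U).mean (fun _ => none) (List.ofFn fun i => (A' i, α i)).reverse F x := by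
  classical
  have h := avg_prod_sum_eq hα F (cyclicChar F) (fun z hz w hw => by
      rw [avg_cyclicChar F hz hw]) A' (fun z => eigenProj U (z : ℂ))
      (fun z => eigenProj U (star (z : ℂ)))
  have hT : truncSum U α A F = avg fun t : Fin k → (charNet U).T F =>
      word ((charNet U).B F) ((charNet U).C F) ((charNet U).γ F)
      (fun _ => none) t (List.ofFn fun i => (A' i, α i)).reverse := by
    refine Eq.trans ?_ (h.symm.trans (congrArg avg (funext fun t => (word_ofFn ((charNet U).B F)
      ((charNet U).C F) ((charNet U).γ F) t A' α).symm)))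
    rw [truncSum]
    refine Finset.sum_congr rfl fun z _ => ?_
    rw [hA']
    congr 3
    funext i
    congr 1
    rw [sharp]
    split_ifs <;> rfl
  rw [hT]
  exact map_avg (ContinuousLinearMap.apply ℂ H x) _

end Identification

end EntangledErgodic

/-! ### The main theorem -/

theorem theorem2p2 {H : Type*} [NormedAddCommGroup H] [InnerProductSpace ℂ H] [CompleteSpace H]
    (U : unitary (H →L[ℂ] H)) (hU : EntangledErgodic.IsAlmostPeriodic U)
    {k : ℕ} (hk : 1 ≤ k) (α : Fin (2 * k) → Fin k) (hα : EntangledErgodic.IsPairPartition α)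
    (A : Fin (2 * k - 1) → H →L[ℂ] H) :
    ∃ S : H →L[ℂ] H, EntangledErgodic.IsEntangledSum U α A S ∧
      ∀ x : H, Tendsto (fun N : ℕ => EntangledErgodic.entangledMean U α A N x) atTop (𝓝 (S x)) := by
  open EntangledErgodic in
  obtain ⟨A', hA'⟩ := exists_altProd_eq_prod (2 * k) A
  have hboth := PairedAverages.exists_tendsto_mean_both hU.dense_span_eigenvectors (powNet U)
    (charNet U) (fun v x => ⟨_, tendsto_avg_pow U (norm_eq_one_of_mem_sigmaPP v.2) x,
      tendsto_avg_charScalar U v.2 x⟩) (List.ofFn fun i => (A' i, α i)).reverse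
    (fun j => (count_letters_ofFn A' α j).trans (hα j))
  choose s hs using hboth
  have hmean : ∀ x, Tendsto (fun N : ℕ => entangledMean U α A N x) atTop (𝓝 (s x)) := by
    intro x
    rw [← tendsto_add_atTop_iff_nat 1]
    simpa only [entangledMean_apply_eq_mean U α A hA'] using (hs x).1
  have htrunc : ∀ x, Tendsto (fun F => truncSum U α A F x) atTop (𝓝 (s x)) := by
    intro x
    simpa only [truncSum_apply_eq_mean U hα A hA'] using (hs x).2
  -- Boundedness of the limit follows from Banach–Steinhaus, applied to the sequence of means rather
  -- than to the net of truncations, whose filter need not be countably generated.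
  refine ⟨continuousLinearMapOfTendsto (fun N => entangledMean U α A N)
    (tendsto_pi_nhds.2 hmean), ?_, hmean⟩
  rw [IsEntangledSum, ContinuousLinearMapWOT.tendsto_iff_forall_inner_apply_tendsto]
  exact fun x y => tendsto_const_nhds.inner (htrunc x)
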